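/- Let $\mathbb K$ be $\mathbb R$ or $\mathbb C$, let $d>2$ and $n$ be natural numbers, and equip $\mathbb K^n$ with the Euclidean norm $\|\cdot\|$. For a tensor $\mathbf z\in\bigotimes^d\mathbb K^n$ let $$\pi(\mathbf z)=\inf\Big\{\sum_{i=1}^r\|z_1^i\|\cdots\|z_d^i\| : r\in\mathbb N,\ \mathbf z=\sum_{i=1}^r z_1^i\otimes\cdots\otimes z_d^i\Big\}$$ be its projective (nuclear) norm. Let $\mathbf z\in\bigotimes^d\mathbb K^n$ be a symmetric tensor, i.e. one that is invariant under all permutations of the $d$ tensor factors, and suppose that $$\mathbf z=\sum_{i=1}^r z_1^i\otimes\cdots\otimes z_d^i\qquad\text{with}\qquad \pi(\mathbf z)=\sum_{i=1}^r\|z_1^i\|\cdots\|z_d^i\|.$$ Then, for every $i\in\{1,\dots,r\}$ whose term $z_1^i\otimes\cdots\otimes z_d^i$ is nonzero (equivalently, $z_1^i,\dots,z_d^i$ are all nonzero), $$\dim\operatorname{span}\{z_1^i,\dots,z_d^i\}=1\ \text{ if }\ \mathbb K=\mathbb C,\qquad \dim\operatorname{span}\{z_1^i,\dots,z_d^i\}\in\{1,2\}\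 \text{ if }\ \mathbb K=\mathbb R.$$ -/

import Mathlib

open scoped TensorProduct

/-- The `d`-fold tensor product `⨂^d 𝕜ⁿ`, where `𝕜ⁿ` carries the Euclidean norm. -/
abbrev TensorPow (𝕜 : Type) [RCLike 𝕜] (d n : ℕ) : Type :=
  ⨂[𝕜] _ : Fin d, EuclideanSpace 𝕜 (Fin n)

/-- A tensor is symmetric if it is fixed by every permutation of the `d` tensor factors. -/
def TensorPow.IsSymmetric {𝕜 : Type} [RCLike 𝕜] {d n : ℕ} (z : TensorPow 𝕜 d n) : Prop :=
  ∀ η : Equiv.Perm (Fin d),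
    PiTensorProduct.reindex 𝕜 (fun _ : Fin d => EuclideanSpace 𝕜 (Fin n)) η z = z

/-- The family `x` of vectors `x i k` is a representation
`z = ∑ i, x i 1 ⊗ ⋯ ⊗ x i d` that attains the projective (nuclear) norm:
`π(z) = ∑ i, ‖x i 1‖ ⋯ ‖x i d‖`. Here `π` is Mathlib's `projectiveSeminorm`; see
`TensorPow.projectiveSeminorm_eq_sInf` for its usual formula. -/
def TensorPow.IsNuclearRepresentation {𝕜 : Type} [RCLike 𝕜] {d n r : ℕ} (z : TensorPow 𝕜 d n)
    (x : Fin r → Fin d → EuclideanSpace 𝕜 (Fin n)) : Prop :=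
  z = ∑ i, PiTensorProduct.tprod 𝕜 (x i) ∧
    PiTensorProduct.projectiveSeminorm z = ∑ i, ∏ k, ‖x i k‖

/-- For `d ≥ 1`, Mathlib's projective seminorm is
`inf {∑ i, ‖x i 1‖ ⋯ ‖x i d‖ : z = ∑ i, x i 1 ⊗ ⋯ ⊗ x i d}`. -/
theorem TensorPow.projectiveSeminorm_eq_sInf {𝕜 : Type} [RCLike 𝕜] {d n : ℕ} (hd : 0 < d)
    (z : TensorPow 𝕜 d n) :
    PiTensorProduct.projectiveSeminorm z =
      sInf {t : ℝ | ∃ (r : ℕ) (x : Fin r → Fin d → EuclideanSpace 𝕜 (Fin n)),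
        z = ∑ i, PiTensorProduct.tprod 𝕜 (x i) ∧ t = ∑ i, ∏ k, ‖x i k‖} := by
  change ‖z‖ = _
  rw [PiTensorProduct.norm_def, iInf]
  congr 1
  ext t
  constructor
  · rintro ⟨⟨p, hp⟩, rfl⟩
    rw [PiTensorProduct.mem_lifts_iff] at hp
    let l := p.toList
    let k₀ : Fin d := ⟨0, hd⟩
    refine ⟨l.length, fun i => Function.update (l.get i).2 k₀ ((l.get i).1 • (l.get i).2 k₀),
      ?_, ?_⟩
    · rw [← hp, ← Fin.sum_univ_fun_getElem p.toList]
      refine Finset.sum_congr rfl fun i _ => ?_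
      rw [MultilinearMap.map_update_smul, Function.update_eq_self]
      rfl
    · simp only [PiTensorProduct.projectiveSeminormAux]
      rw [← Fin.sum_univ_fun_getElem p.toList]
      refine Finset.sum_congr rfl fun i _ => ?_
      rw [← Finset.mul_prod_erase _ _ (Finset.mem_univ k₀),
        ← Finset.mul_prod_erase (a := k₀) _ (fun k => ‖Function.update _ _ _ k‖)
          (Finset.mem_univ k₀), Function.update_self, norm_smul, mul_assoc]
      refine congrArg₂ _ rfl (congrArg₂ _ rfl (Finset.prod_congr rfl fun k hk => ?_))
      rw [Function.update_of_ne (Finset.ne_of_mem_erase hk)]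
      rfl
  · rintro ⟨r, x, hz, rfl⟩
    refine ⟨⟨FreeAddMonoid.ofList (List.ofFn fun i => ((1 : 𝕜), x i)), ?_⟩, ?_⟩
    · rw [PiTensorProduct.mem_lifts_iff, hz]
      simp [List.map_ofFn, List.sum_ofFn]
    · simp [PiTensorProduct.projectiveSeminormAux, List.map_ofFn, List.sum_ofFn]

/-! A norming functional of `z` turns a nuclear representation into equality in every term. As `z`
is symmetric, permuting the factors gives another nuclear representation, so averaging the
functional over permutations yields a symmetric form of norm at most one that attains its norm at
each term.

Freeze all but three slots at unit vectors `x`, `y`, `e`. Equality in Cauchy-Schwarz makes the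
operator of `T · e ·` swap `x` and `y`, so `x + y` and `x - y` are eigenvectors for `1` and `-1`.
Each expresses `T e e ·` through a reflection of `e`, with opposite signs; adding them puts `e` in
the span of `x` and `y`. Over `ℂ`, changing phases excludes dimension two. -/

/-! ### Norm attainment of real symmetric trilinear forms. -/

section Trilinear

variable {E : Type*} [NormedAddCommGroup E] [InnerProductSpace ℝ E]

open scoped RealInnerProductSpace

/-- A functional attaining its norm bound at `c` is a multiple of the inner product with `c`. -/
theorem LinearMap.norm_mul_eq_mul_inner_of_attains [CompleteSpace E] (f : E →ₗ[ℝ] ℝ) {M : ℝ}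
    (hM : 0 ≤ M) (hf : ∀ w, |f w| ≤ M * ‖w‖) {c : E} (hc : f c = M * ‖c‖) (w : E) :
    ‖c‖ * f w = M * ⟪c, w⟫ := by
  let F : StrongDual ℝ E := f.mkContinuous M hf
  let y : E := (InnerProductSpace.toDual ℝ E).symm F
  have hy (v : E) : ⟪y, v⟫ = f v := InnerProductSpace.toDual_symm_apply
  have hnorm : ‖y‖ ≤ M := by
    rw [LinearIsometryEquiv.norm_map]
    exact f.mkContinuous_norm_le hM hf
  -- The squared norm equals `‖c‖² * (‖y‖² - M²)`, which is at most zero.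
  have hzero : ‖c‖ • y - M • c = 0 := by
    rw [← norm_eq_zero, ← sq_eq_zero_iff]
    refine le_antisymm ?_ (sq_nonneg _)
    rw [norm_sub_sq_real, real_inner_smul_left, real_inner_smul_right, hy, hc, norm_smul,
      norm_smul, norm_norm, Real.norm_of_nonneg hM]
    have := mul_le_mul_of_nonneg_left (pow_le_pow_left₀ (norm_nonneg y) hnorm 2) (sq_nonneg ‖c‖)
    linarith
  have := congrArg (⟪·, w⟫) (sub_eq_zero.mp hzero)
  simpa [real_inner_smul_left, hy] using this

/-- If `u` is fixed by the form `T · e ·`, then `T e e ·` is the reflection of `e` in `u`. -/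
theorem trilinear_apply_self_of_apply_eq_inner [CompleteSpace E] (T : E → E → E →ₗ[ℝ] ℝ)
    (h12 : ∀ a b c, T a b c = T b a c) (h23 : ∀ a b c, T a b c = T a c b)
    (hT : ∀ a b c, |T a b c| ≤ ‖a‖ * ‖b‖ * ‖c‖) {u e : E} (hu : ‖u‖ = 1) (he : ‖e‖ = 1)
    (hue : ∀ w, T u e w = ⟪u, w⟫) (w : E) : T e e w = 2 * ⟪u, e⟫ * ⟪u, w⟫ - ⟪e, w⟫ := by
  have huu : ⟪u, u⟫ = 1 := by rw [real_inner_self_eq_norm_sq, hu, one_pow]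
  have huuw (v : E) : T u u v = ⟪e, v⟫ := by
    have := (T u u).norm_mul_eq_mul_inner_of_attains (by positivity) (hT u u)
      (c := e) (by rw [h23, hue, huu, hu, he]; norm_num) v
    simpa [hu, he] using this
  have hadd (v : E) : T (u + e) (u + e) v = T u u v + 2 * T u e v + T e e v := by
    have hl (a b c d : E) : T (a + b) c d = T a c d + T b c d := by
      rw [h12, h23, map_add, ← h23 c a, ← h23 c b, h12 c a, h12 c b]
    rw [hl, h12 u, h12 e, hl, hl, h12 e u]
    ring
  have hnorm : ‖u + e‖ * ‖u + e‖ = 2 + 2 * ⟪u, e⟫ := by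
    rw [← sq, norm_add_sq_real, hu, he]
    ring
  -- The value at `u` is `2 + 2 * ⟪u, e⟫ = ‖u + e‖²`, the maximum allowed by the bound.
  have := (T (u + e) (u + e)).norm_mul_eq_mul_inner_of_attains (by positivity)
    (hT (u + e) (u + e)) (c := u) (by
      rw [hadd, huuw, hue, huu, h23 e e u, h12 e u e, hue, hnorm, hu, real_inner_comm]
      ring) w
  rw [hadd, huuw, hue, hnorm, hu] at this
  linarith

/-- A symmetric trilinear form of norm at most one that attains its norm at unit vectors `x`, `y`,
`e` does so at linearly dependent vectors. -/
theorem trilinear_exists_combination_of_attains [CompleteSpace E] (T : E → E → E →ₗ[ℝ] ℝ)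
    (h12 : ∀ a b c, T a b c = T b a c) (h23 : ∀ a b c, T a b c = T a c b)
    (hT : ∀ a b c, |T a b c| ≤ ‖a‖ * ‖b‖ * ‖c‖) {x y e : E} (hx : ‖x‖ = 1) (hy : ‖y‖ = 1)
    (he : ‖e‖ = 1) (hxye : T x y e = 1) (hne : x ≠ y) (hne' : x ≠ -y) :
    ∃ a b : ℝ, e = a • x + b • y := by
  have hxe (w : E) : T x e w = ⟪y, w⟫ := by
    have := (T x e).norm_mul_eq_mul_inner_of_attains (by positivity) (hT x e) (c := y)
      (by rw [h23, hxye, hx, hy, he]; norm_num) w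
    simpa [hx, hy, he] using this
  have hye (w : E) : T y e w = ⟪x, w⟫ := by
    have := (T y e).norm_mul_eq_mul_inner_of_attains (by positivity) (hT y e) (c := x)
      (by rw [h23, h12, hxye, hx, hy, he]; norm_num) w
    simpa [hx, hy, he] using this
  let u := x + y
  let v := x - y
  have hu0 : ‖u‖ ≠ 0 := by
    rw [norm_ne_zero_iff]
    exact fun h => hne' (eq_neg_of_add_eq_zero_left h)
  have hv0 : ‖v‖ ≠ 0 := by
    rw [norm_ne_zero_iff]
    exact fun h => hne (sub_eq_zero.mp h)
  have hu (w : E) : T (‖u‖⁻¹ • u) e w = ⟪‖u‖⁻¹ • u, w⟫ := by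
    rw [h12, h23, map_smul, map_add, h23, h12, hxe, h23, h12 e y, hye, real_inner_smul_left,
      inner_add_left, smul_eq_mul, add_comm]
  have hv (w : E) : -T (‖v‖⁻¹ • v) e w = ⟪‖v‖⁻¹ • v, w⟫ := by
    rw [h12, h23, map_smul, map_sub, h23, h12, hxe, h23, h12 e y, hye, real_inner_smul_left,
      inner_sub_left, smul_eq_mul]
    ring
  have hru := trilinear_apply_self_of_apply_eq_inner T h12 h23 hT
    (by rw [norm_smul, norm_inv, norm_norm, inv_mul_cancel₀ hu0]) he hu
  -- Passing to `-T` turns the eigenvalue `-1` into `1`.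
  have hrv := trilinear_apply_self_of_apply_eq_inner (fun a b => -T a b)
    (fun a b c => congrArg Neg.neg (h12 a b c)) (fun a b c => congrArg Neg.neg (h23 a b c))
    (fun a b c => by simpa using hT a b c)
    (by rw [norm_smul, norm_inv, norm_norm, inv_mul_cancel₀ hv0]) he hv
  have hsum : e = ⟪‖u‖⁻¹ • u, e⟫ • ‖u‖⁻¹ • u + ⟪‖v‖⁻¹ • v, e⟫ • ‖v‖⁻¹ • v := by
    refine ext_inner_right ℝ fun w => ?_
    have h1 := hru w
    have h2 := hrv w
    rw [LinearMap.neg_apply] at h2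
    rw [inner_add_left, real_inner_smul_left (‖u‖⁻¹ • u), real_inner_smul_left (‖v‖⁻¹ • v)]
    linarith
  refine ⟨⟪‖u‖⁻¹ • u, e⟫ * ‖u‖⁻¹ + ⟪‖v‖⁻¹ • v, e⟫ * ‖v‖⁻¹,
    ⟪‖u‖⁻¹ • u, e⟫ * ‖u‖⁻¹ - ⟪‖v‖⁻¹ • v, e⟫ * ‖v‖⁻¹, ?_⟩
  conv_lhs => rw [hsum]
  rw [smul_smul, smul_smul]
  generalize ⟪‖u‖⁻¹ • u, e⟫ * ‖u‖⁻¹ = s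
  generalize ⟪‖v‖⁻¹ • v, e⟫ * ‖v‖⁻¹ = t
  simp only [u, v]
  module

end Trilinear

/-! ### From three slots to multilinear forms over `ℝ` and `ℂ`. -/

section Multilinear

variable {ι : Type*} [Fintype ι]

/-- A real symmetric multilinear form of norm at most one that attains its norm at unit vectors
does so at vectors any three of which are linearly dependent. -/
theorem MultilinearMap.exists_combination_of_attains {E : Type*} [NormedAddCommGroup E]
    [InnerProductSpace ℝ E] [CompleteSpace E] (φ : MultilinearMap ℝ (fun _ : ι => E) ℝ)
    (hsymm : ∀ (σ : Equiv.Perm ι) (y : ι → E), φ (fun a => y (σ a)) = φ y)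
    (hφ : ∀ y, |φ y| ≤ ∏ a, ‖y a‖) {y : ι → E} (hy : ∀ a, ‖y a‖ = 1) (hatt : φ y = 1)
    {i j k : ι} (hij : i ≠ j) (hik : i ≠ k) (hjk : j ≠ k) (hne : y i ≠ y j)
    (hne' : y i ≠ -y j) : ∃ a b : ℝ, y k = a • y i + b • y j := by
  classical
  refine trilinear_exists_combination_of_attains
    (fun a b => φ.toLinearMap (Function.update (Function.update y i a) j b) k)
    (fun a b c => ?_) (fun a b c => ?_) (fun a b c => ?_) (hy i) (hy j) (hy k) ?_ hne hne'
  · rw [MultilinearMap.toLinearMap_apply, MultilinearMap.toLinearMap_apply,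
      ← hsymm (Equiv.swap i j)]
    congr 1
    ext l
    by_cases hi : l = i
    · subst hi; simp [hij, hik, hjk]
    by_cases hj : l = j
    · subst hj; simp [hij, hik, hjk]
    simp [Equiv.swap_apply_of_ne_of_ne hi hj, Function.update_apply, hi, hj]
  · rw [MultilinearMap.toLinearMap_apply, MultilinearMap.toLinearMap_apply,
      ← hsymm (Equiv.swap j k)]
    congr 1
    ext l
    by_cases hj : l = j
    · subst hj; simp [hjk]
    by_cases hk : l = k
    · subst hk; simp [hjk]
    simp [Equiv.swap_apply_of_ne_of_ne hj hk, Function.update_apply, hj, hk]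
  · rw [MultilinearMap.toLinearMap_apply]
    refine (hφ _).trans_eq ?_
    rw [← Finset.prod_subset (Finset.subset_univ {i, j, k}) fun l _ hl => ?_,
      Finset.prod_insert (by simp [hij, hik]), Finset.prod_insert (by simp [hjk]),
      Finset.prod_singleton]
    · simp [hij, hik, hjk, mul_assoc]
    · simp only [Finset.mem_insert, Finset.mem_singleton, not_or] at hl
      simp [hl, hy]
  · simpa using hatt

/-- A complex symmetric multilinear form of norm at most one (on at least three vectors) that
attains its norm at unit vectors does so at pairwise parallel vectors. -/
theorem MultilinearMap.exists_smul_eq_of_attains {E : Type*} [NormedAddCommGroup E]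
    [InnerProductSpace ℂ E] [CompleteSpace E] (φ : MultilinearMap ℂ (fun _ : ι => E) ℂ)
    (hsymm : ∀ (σ : Equiv.Perm ι) (y : ι → E), φ (fun a => y (σ a)) = φ y)
    (hφ : ∀ y, ‖φ y‖ ≤ ∏ a, ‖y a‖) {y : ι → E} (hy : ∀ a, ‖y a‖ = 1) (hatt : φ y = 1)
    {i j k : ι} (hij : i ≠ j) (hik : i ≠ k) (hjk : j ≠ k) : ∃ c : ℂ, y j = c • y i := by
  classical
  let : InnerProductSpace ℝ E := InnerProductSpace.complexToReal
  by_contra! hpar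
  have hind : LinearIndependent ℂ ![y i, y j] :=
    (LinearIndependent.pair_iff' (norm_ne_zero_iff.mp (by simp [hy]))).mpr
      fun c hc => hpar c hc.symm
  rw [LinearIndependent.pair_iff] at hind
  let ψ : MultilinearMap ℝ (fun _ : ι => E) ℝ :=
    Complex.reLm.compMultilinearMap (φ.restrictScalars ℝ)
  have hψs (σ : Equiv.Perm ι) (z : ι → E) : ψ (fun a => z (σ a)) = ψ z :=
    congrArg Complex.re (hsymm σ z)
  have hψ (z : ι → E) : |ψ z| ≤ ∏ a, ‖z a‖ := (Complex.abs_re_le_norm _).trans (hφ z)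
  -- These phases have product one, so the rotated vectors attain the norm too. The real case then
  -- writes `y k` both with real and with purely imaginary coefficients, forcing `y k = 0`.
  let m : ι → ℂ := Function.update (Function.update 1 i Complex.I) j (-Complex.I)
  have hmi : m i = Complex.I := by simp [m, hij]
  have hmj : m j = -Complex.I := by simp [m]
  have hm1 (l : ι) (hi : l ≠ i) (hj : l ≠ j) : m l = 1 := by simp [m, hi, hj]
  have hmprod : ∏ a, m a = 1 := by
    rw [← Finset.prod_subset (Finset.subset_univ {i, j}) fun l _ hl => ?_,
      Finset.prod_pair hij, hmi, hmj]
    · simp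
    · simp only [Finset.mem_insert, Finset.mem_singleton, not_or] at hl
      exact hm1 l hl.1 hl.2
  have hmnorm (a : ι) : ‖m a‖ = 1 := by
    by_cases hi : a = i
    · subst hi; simp [hmi]
    by_cases hj : a = j
    · subst hj; simp [hmj]
    simp [hm1 a hi hj]
  obtain ⟨a, b, hab⟩ := ψ.exists_combination_of_attains hψs hψ hy
    (show (φ y).re = 1 by simp [hatt]) hij hik hjk
    (fun h => hpar 1 (by simp [h])) (fun h => hpar (-1) (by simp [h]))
  obtain ⟨a', b', hab'⟩ := ψ.exists_combination_of_attains hψs hψ (y := fun l => m l • y l)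
    (fun l => by rw [norm_smul, hmnorm, hy, one_mul])
    (show (φ fun l => m l • y l).re = 1 by
      rw [φ.map_smul_univ, hmprod, hatt]; simp) hij hik hjk
    (fun h => hpar (-1) (by
      rw [hmi, hmj, neg_smul, ← smul_neg] at h
      rw [neg_one_smul, smul_right_injective E Complex.I_ne_zero h, neg_neg]))
    (fun h => hpar 1 (by
      rw [hmi, hmj, neg_smul, neg_neg] at h
      rw [one_smul, smul_right_injective E Complex.I_ne_zero h]))
  simp only [hm1 k hik.symm hjk.symm, one_smul, hmi, hmj] at hab'
  simp only [← Complex.coe_smul, smul_smul] at hab hab'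
  have hdiff := hind (a - a' * Complex.I) (b + b' * Complex.I) (by
    have := hab.symm.trans hab'
    rw [← sub_eq_zero] at this
    rw [← this]
    module)
  have ha : (a : ℂ) = 0 := by
    have := congrArg Complex.re hdiff.1
    simp at this
    simp [this]
  have hb : (b : ℂ) = 0 := by
    have := congrArg Complex.re hdiff.2
    simp at this
    simp [this]
  have := hy k
  simp [hab, ha, hb] at this

end Multilinear

/-! ### Symmetric norming forms for nuclear representations. -/

/-- Every term of a nuclear representation of a symmetric tensor is normed by a symmetric
multilinear form of norm at most one. -/
theorem TensorPow.IsNuclearRepresentation.exists_symmetric_form {𝕜 : Type} [RCLike 𝕜]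
    {d n r : ℕ} {z : TensorPow 𝕜 d n} (hz : z.IsSymmetric)
    {x : Fin r → Fin d → EuclideanSpace 𝕜 (Fin n)} (hx : z.IsNuclearRepresentation x)
    (i : Fin r) :
    ∃ φ : MultilinearMap 𝕜 (fun _ : Fin d => EuclideanSpace 𝕜 (Fin n)) 𝕜,
      (∀ (σ : Equiv.Perm (Fin d)) (y : Fin d → EuclideanSpace 𝕜 (Fin n)),
        φ (fun a => y (σ a)) = φ y) ∧
      (∀ y, ‖φ y‖ ≤ ∏ a, ‖y a‖) ∧ φ (x i) = ((∏ a, ‖x i a‖ : ℝ) : 𝕜) := by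
  obtain ⟨g, hg, hgz⟩ := exists_dual_vector'' 𝕜 z
  have hgt (y : Fin d → EuclideanSpace 𝕜 (Fin n)) :
      ‖g (PiTensorProduct.tprod 𝕜 y)‖ ≤ ∏ a, ‖y a‖ :=
    (g.le_of_opNorm_le hg _).trans
      (by rw [one_mul]; exact PiTensorProduct.projectiveSeminorm_tprod_le y)
  have hterm (σ : Equiv.Perm (Fin d)) :
      g (PiTensorProduct.tprod 𝕜 fun a => x i (σ a)) = ((∏ a, ‖x i a‖ : ℝ) : 𝕜) := by
    have hbd (l : Fin r) : ‖g (PiTensorProduct.tprod 𝕜 fun a => x l (σ a))‖ ≤ ∏ a, ‖x l a‖ :=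
      (hgt _).trans_eq (Equiv.prod_comp σ fun a => ‖x l a‖)
    have hsum : ∑ l, RCLike.re (g (PiTensorProduct.tprod 𝕜 fun a => x l (σ a))) =
        ∑ l, ∏ a, ‖x l a‖ := by
      rw [← hx.2, ← map_sum, ← map_sum]
      have : ∑ l, PiTensorProduct.tprod 𝕜 (fun a => x l (σ a)) = z := by
        conv_rhs => rw [← hz σ.symm, hx.1, map_sum]
        simp
      rw [this, hgz, RCLike.ofReal_re]
      rfl
    -- Equal sums with termwise inequality force equality in each term; a real part equal to the
    -- norm bound then determines the value itself.
    have hre := (Finset.sum_eq_sum_iff_of_le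
      fun l _ => (RCLike.re_le_norm _).trans (hbd l)).mp hsum i (Finset.mem_univ i)
    have hnorm := RCLike.norm_le_re_iff_eq_norm.mp ((hbd i).trans_eq hre.symm)
    rw [hnorm, RCLike.ofReal_re] at hre
    rw [hnorm, hre]
  refine ⟨((Nat.factorial d : 𝕜)⁻¹) • ∑ σ : Equiv.Perm (Fin d),
    (g.toLinearMap.compMultilinearMap (PiTensorProduct.tprod 𝕜)).domDomCongr σ,
    fun τ y => ?_, fun y => ?_, ?_⟩
  · simp only [smul_apply, sum_apply,
      MultilinearMap.domDomCongr_apply]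
    congr 1
    exact Fintype.sum_equiv (Equiv.mulLeft τ) _ _ fun σ => rfl
  · simp only [smul_apply, sum_apply,
      MultilinearMap.domDomCongr_apply]
    rw [norm_smul, norm_inv, RCLike.norm_natCast,
      inv_mul_le_iff₀ (by exact_mod_cast d.factorial_pos)]
    refine (norm_sum_le_of_le _ fun σ _ => (hgt _).trans_eq
      (Equiv.prod_comp σ fun a => ‖y a‖)).trans_eq ?_
    simp [Fintype.card_perm]
  · simp only [smul_apply, sum_apply,
      MultilinearMap.domDomCongr_apply, LinearMap.compMultilinearMap_apply]
    have : (Nat.factorial d : 𝕜) ≠ 0 := by exact_mod_cast d.factorial_ne_zero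
    rw [Finset.sum_congr rfl fun σ _ => show g.toLinearMap _ = _ from hterm σ]
    simp [Fintype.card_perm, this]

/-- The normalized vectors of a nonzero term are normed to one by a symmetric form. -/
theorem TensorPow.IsNuclearRepresentation.exists_symmetric_form_normalized {𝕜 : Type} [RCLike 𝕜]
    {d n r : ℕ} {z : TensorPow 𝕜 d n} (hz : z.IsSymmetric)
    {x : Fin r → Fin d → EuclideanSpace 𝕜 (Fin n)} (hx : z.IsNuclearRepresentation x)
    (i : Fin r) (hi : ∀ k, x i k ≠ 0) :
    ∃ φ : MultilinearMap 𝕜 (fun _ : Fin d => EuclideanSpace 𝕜 (Fin n)) 𝕜,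
      (∀ (σ : Equiv.Perm (Fin d)) (y : Fin d → EuclideanSpace 𝕜 (Fin n)),
        φ (fun a => y (σ a)) = φ y) ∧
      (∀ y, ‖φ y‖ ≤ ∏ a, ‖y a‖) ∧ φ (fun a => ((‖x i a‖⁻¹ : ℝ) : 𝕜) • x i a) = 1 := by
  obtain ⟨φ, hs, hb, ha⟩ := hx.exists_symmetric_form hz i
  refine ⟨φ, hs, hb, ?_⟩
  rw [φ.map_smul_univ, ha, smul_eq_mul]
  rw [← RCLike.ofReal_prod, ← RCLike.ofReal_mul, Finset.prod_inv_distrib, inv_mul_cancel₀,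
    RCLike.ofReal_one]
  exact Finset.prod_ne_zero_iff.mpr fun a _ => norm_ne_zero_iff.mpr (hi a)

/-! ### Dimension of the span of each term. -/

theorem mainTheorem1 (d n : ℕ) (hd : 2 < d) :
    (∀ z : TensorPow ℂ d n, z.IsSymmetric →
      ∀ (r : ℕ) (x : Fin r → Fin d → EuclideanSpace ℂ (Fin n)), z.IsNuclearRepresentation x →
        ∀ i : Fin r, (∀ k, x i k ≠ 0) →
          Module.finrank ℂ (Submodule.span ℂ (Set.range (x i))) = 1) ∧
    (∀ z : TensorPow ℝ d n, z.IsSymmetric →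
      ∀ (r : ℕ) (x : Fin r → Fin d → EuclideanSpace ℝ (Fin n)), z.IsNuclearRepresentation x →
        ∀ i : Fin r, (∀ k, x i k ≠ 0) →
          Module.finrank ℝ (Submodule.span ℝ (Set.range (x i))) = 1 ∨
            Module.finrank ℝ (Submodule.span ℝ (Set.range (x i))) = 2) := by
  let k₀ : Fin d := ⟨0, by omega⟩
  -- This is where `2 < d` enters: the complex argument needs a third slot.
  have hthird (k : Fin d) : ∃ l : Fin d, k₀ ≠ l ∧ k ≠ l := by
    obtain ⟨l, hl⟩ := Finset.exists_mem_notMem_of_card_lt_card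
      (s := {k₀, k}) (t := (Finset.univ : Finset (Fin d)))
      (Finset.card_le_two.trans_lt (by simpa using hd))
    simp only [Finset.mem_univ, Finset.mem_insert, Finset.mem_singleton, not_or, true_and] at hl
    exact ⟨l, Ne.symm hl.1, Ne.symm hl.2⟩
  refine ⟨fun z hz r x hx i hi => ?_, fun z hz r x hx i hi => ?_⟩
  · obtain ⟨φ, hs, hb, ha⟩ := hx.exists_symmetric_form_normalized hz i hi
    have hc (a : Fin d) : ((‖x i a‖⁻¹ : ℝ) : ℂ) ≠ 0 := by simp [hi a]
    have hmem (k : Fin d) : x i k ∈ Submodule.span ℂ {x i k₀} := by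
      by_cases hk : k₀ = k
      · exact hk ▸ Submodule.mem_span_singleton_self _
      obtain ⟨l, hl, hl'⟩ := hthird k
      obtain ⟨c, hck⟩ := φ.exists_smul_eq_of_attains hs hb
        (fun a => by simp [norm_smul, hi a]) ha hk hl hl'
      rw [← Submodule.smul_mem_iff _ (hc k)]
      refine hck ▸ Submodule.smul_mem _ _ (Submodule.smul_mem _ _ ?_)
      exact Submodule.mem_span_singleton_self _
    rw [le_antisymm (Submodule.span_le.mpr (Set.range_subset_iff.mpr hmem))
      (Submodule.span_mono (Set.singleton_subset_iff.mpr (Set.mem_range_self k₀)))]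
    exact finrank_span_singleton (hi k₀)
  · obtain ⟨φ, hs, hb, ha⟩ := hx.exists_symmetric_form_normalized hz i hi
    have hc (a : Fin d) : ‖x i a‖⁻¹ ≠ 0 := by simp [hi a]
    by_cases hpar : ∀ k, x i k ∈ Submodule.span ℝ {x i k₀}
    · left
      rw [le_antisymm (Submodule.span_le.mpr (Set.range_subset_iff.mpr hpar))
        (Submodule.span_mono (Set.singleton_subset_iff.mpr (Set.mem_range_self k₀)))]
      exact finrank_span_singleton (hi k₀)
    right
    push Not at hpar
    obtain ⟨k, hk⟩ := hpar
    have hne : k₀ ≠ k := fun h => hk (h ▸ Submodule.mem_span_singleton_self _)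
    have hmem (l : Fin d) : x i l ∈ Submodule.span ℝ {x i k₀, x i k} := by
      by_cases hl : k₀ = l
      · exact hl ▸ Submodule.mem_span_of_mem (by simp)
      by_cases hl' : k = l
      · exact hl' ▸ Submodule.mem_span_of_mem (by simp)
      obtain ⟨a, b, hab⟩ := φ.exists_combination_of_attains hs hb
        (fun a => by simp [norm_smul, hi a]) ha hne hl hl'
        (fun h => hk <| by
          rw [← Submodule.smul_mem_iff _ (hc k)]
          exact h ▸ Submodule.smul_mem _ _ (Submodule.mem_span_singleton_self _))
        (fun h => hk <| by
          rw [← Submodule.smul_mem_iff _ (hc k), ← Submodule.neg_mem_iff]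
          exact h ▸ Submodule.smul_mem _ _ (Submodule.mem_span_singleton_self _))
      rw [← Submodule.smul_mem_iff _ (hc l)]
      refine hab ▸ Submodule.add_mem _ ?_ ?_ <;>
        exact Submodule.smul_mem _ _ (Submodule.smul_mem _ _ (Submodule.mem_span_of_mem (by simp)))
    have hspan : Submodule.span ℝ (Set.range (x i)) =
        Submodule.span ℝ (Set.range ![x i k₀, x i k]) := by
      refine le_antisymm (Submodule.span_le.mpr (Set.range_subset_iff.mpr ?_))
        (Submodule.span_mono ?_)
      · simpa only [Matrix.range_cons, Matrix.range_empty, Set.union_empty, Set.singleton_union,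
          SetLike.mem_coe] using hmem
      · simp [Set.insert_subset_iff]
    rw [hspan, finrank_span_eq_card, Fintype.card_fin]
    exact (LinearIndependent.pair_iff' (hi k₀)).mpr
      fun c hc' => hk (Submodule.mem_span_singleton.mpr ⟨c, hc'⟩)
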